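/- Let $\lambda,c,t>0$, let $p,q\ge 0$ with $p+q\le 1$, and let $\alpha\in\mathbb{R}$. A particle starts at the origin of the plane at time $0$ and moves with constant speed $c$ along one of the four directions $d_j=\left(\cos\frac{\pi j}{2},\sin\frac{\pi j}{2}\right)$, $j\in\mathbb{Z}/4\mathbb{Z}$. The initial direction is uniform on $\{d_0,d_1,d_2,d_3\}$. At the events of a homogeneous Poisson process of rate $\lambda$ (whose waiting times are independent and exponential with parameter $\lambda$) the direction changes: independently at each event, the current direction $d_j$ is replaced by $d_{j+1}$ with probability $p$ (counter-clockwise turn), by $d_{j-1}$ with probability $q$ (clockwise turn), and by $d_{j+2}$ with probability $1-p-q$ (reversal). The initial direction, the Poisson process and the turns are independent. Let $(X(t),Y(t))$ be the position of the particle at time $t$. **Theorem.** The bounded random variable $e^{i\alpha(X(t)-Y(t))}\,\mathbf 1_{\{X(t)+Y(t)=ct\}}$ is integrable. If $\lambda^2pq\neq\alpha^2c^2$, then $$\mathbb{E}\left[e^{i\alpha(X(t)-Y(t))}\,\mathbf 1_{\{X(t)+Y(t)=ct\}}\right]=\frac{e^{-\lambda t}}{4}\left[\left(1+\frac{\lambda(p+q)}{2\sqrt{\lambda^2pq-\alpha^2c^2}}\right)e^{t\sqrt{\lambda^2pq-\alpha^2c^2}}+\left(1-\frac{\lambda(p+q)}{2\sqrt{\lambda^2pq-\alpha^2c^2}}\right)e^{-t\sqrt{\lambda^2pq-\alpha^2c^2}}\right],$$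 where $\sqrt{\lambda^2pq-\alpha^2c^2}$ denotes either of the two complex square roots (the right-hand side does not depend on the choice). If $\lambda^2pq=\alpha^2c^2$, then the expectation equals the limiting value of this expression as the square root tends to $0$, namely $$\mathbb{E}\left[e^{i\alpha(X(t)-Y(t))}\,\mathbf 1_{\{X(t)+Y(t)=ct\}}\right]=\frac{e^{-\lambda t}}{4}\left[2+\lambda(p+q)t\right].$$ -/

import Mathlib

open MeasureTheory ProbabilityTheory

/-- The random ingredients of the planar motion with Poisson rate `lam` and turning probabilities
`p` (counter-clockwise), `q` (clockwise) and `1 - p - q` (reversal).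

Directions are labelled by `ZMod 4`: the label `j` stands for the unit vector
`d_j = (cos (π j / 2), sin (π j / 2))`.
* `D₀` is the initial direction, uniform on the four directions.
* `τ n` is the waiting time between the `n`-th and the `(n+1)`-st Poisson event (the `0`-th being
  the time origin); these are i.i.d. exponential with parameter `lam`.
* `ξ n` is the turn made at the `(n+1)`-st Poisson event; these are i.i.d., equal to `1` with
  probability `p`, to `-1` with probability `q` and to `2` with probability `1 - p - q`.

The initial direction, the waiting times and the turns are independent of each other. -/
structure IsMotionData {Ω : Type*} [MeasurableSpace Ω] (μ : Measure Ω) (lam p q : ℝ)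
    (D₀ : Ω → ZMod 4) (τ : ℕ → Ω → ℝ) (ξ : ℕ → Ω → ZMod 4) : Prop where
  measurable_init : Measurable D₀
  measurable_wait : ∀ n, Measurable (τ n)
  measurable_turn : ∀ n, Measurable (ξ n)
  prob_init : ∀ j : ZMod 4, μ {ω | D₀ ω = j} = 1 / 4
  law_wait : ∀ n, μ.map (τ n) = expMeasure lam
  prob_ccw : ∀ n, μ {ω | ξ n ω = 1} = ENNReal.ofReal p
  prob_cw : ∀ n, μ {ω | ξ n ω = -1} = ENNReal.ofReal q
  prob_reverse : ∀ n, μ {ω | ξ n ω = 2} = ENNReal.ofReal (1 - p - q)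
  indep_wait : iIndepFun τ μ
  indep_turn : iIndepFun ξ μ
  indep_wait_turn : IndepFun (fun ω n => τ n ω) (fun ω n => ξ n ω) μ
  indep_init : IndepFun D₀ (fun ω => ((fun n => τ n ω), (fun n => ξ n ω))) μ

/-- The time of the `n`-th Poisson event (`n ≥ 1`; the value at `n = 0` is `0`). -/
noncomputable def arrivalTime {Ω : Type*} (τ : ℕ → Ω → ℝ) (n : ℕ) (ω : Ω) : ℝ :=
  ∑ k ∈ Finset.range n, τ k ω

/-- `N(t)`: the number of Poisson events in `[0, t]`. -/
noncomputable def eventCount {Ω : Type*} (τ : ℕ → Ω → ℝ) (t : ℝ) (ω : Ω) : ℕ :=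
  Set.ncard {n : ℕ | 1 ≤ n ∧ arrivalTime τ n ω ≤ t}

/-- `D(t)`: the label of the direction at time `t`, that is the initial one changed by all the
turns made up to time `t`. -/
noncomputable def direction {Ω : Type*} (D₀ : Ω → ZMod 4) (τ : ℕ → Ω → ℝ) (ξ : ℕ → Ω → ZMod 4)
    (t : ℝ) (ω : Ω) : ZMod 4 :=
  D₀ ω + ∑ k ∈ Finset.range (eventCount τ t ω), ξ k ω

/-- `X(t)`: the abscissa of a particle that starts at the origin and moves with speed `c` in the
direction `d_{D(s)}` at each time `s`. -/
noncomputable def posX {Ω : Type*} (c : ℝ) (D₀ : Ω → ZMod 4) (τ : ℕ → Ω → ℝ)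
    (ξ : ℕ → Ω → ZMod 4) (t : ℝ) (ω : Ω) : ℝ :=
  ∫ s in (0 : ℝ)..t, c * Real.cos (Real.pi / 2 * ((direction D₀ τ ξ s ω).val : ℝ))

/-- `Y(t)`: the ordinate of that particle. -/
noncomputable def posY {Ω : Type*} (c : ℝ) (D₀ : Ω → ZMod 4) (τ : ℕ → Ω → ℝ)
    (ξ : ℕ → Ω → ZMod 4) (t : ℝ) (ω : Ω) : ℝ :=
  ∫ s in (0 : ℝ)..t, c * Real.sin (Real.pi / 2 * ((direction D₀ τ ξ s ω).val : ℝ))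

/-- The random variable `e^{iα(X(t) - Y(t))} 1{X(t) + Y(t) = ct}`. -/
noncomputable def sideExp {Ω : Type*} (c : ℝ) (D₀ : Ω → ZMod 4) (τ : ℕ → Ω → ℝ)
    (ξ : ℕ → Ω → ZMod 4) (α t : ℝ) : Ω → ℂ :=
  Set.indicator {ω | posX c D₀ τ ξ t ω + posY c D₀ τ ξ t ω = c * t}
    (fun ω => Complex.exp (Complex.I * ((α * (posX c D₀ τ ξ t ω - posY c D₀ τ ξ t ω) : ℝ) : ℂ)))

/-! The argument is a first-step analysis at the first Poisson event. The sum `X + Y` grows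
with speed `c` along `d₀` and `d₁` and decreases with speed `c` along `d₂` and `d₃`, so
`X(t) + Y(t) = ct` forces the particle to use the directions `d₀` and `d₁` only. Hence the means
`F₀` and `F₁` of the random variable, given the initial direction, satisfy the closed system of
renewal equations
`F₀(t) = e^{(-λ + iαc)t} + ∫₀ᵗ e^{(-λ + iαc)x} λp F₁(t - x) dx` and
`F₁(t) = e^{(-λ - iαc)t} + ∫₀ᵗ e^{(-λ - iαc)x} λq F₀(t - x) dx`,
the integrated form of a linear system of differential equations with constant coefficients, whose
matrix has the eigenvalues `-λ ± √(λ²pq - α²c²)`. The expectation is `(F₀(t) + F₁(t)) / 4`. -/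

open Filter

theorem hasDerivAt_cexp_mul_ofReal (a : ℂ) (t : ℝ) :
    HasDerivAt (fun s : ℝ => Complex.exp (a * s)) (Complex.exp (a * t) * a) t := by
  simpa using ((hasDerivAt_id (t : ℂ)).const_mul a).cexp.comp_ofReal

theorem hasDerivAt_cosh_mul_ofReal (s : ℂ) (t : ℝ) :
    HasDerivAt (fun x : ℝ => Complex.cosh (s * x)) (Complex.sinh (s * t) * s) t := by
  simpa using ((hasDerivAt_id (t : ℂ)).const_mul s).ccosh.comp_ofReal

theorem hasDerivAt_sinh_mul_ofReal (s : ℂ) (t : ℝ) :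
    HasDerivAt (fun x : ℝ => Complex.sinh (s * x)) (Complex.cosh (s * t) * s) t := by
  simpa using ((hasDerivAt_id (t : ℂ)).const_mul s).csinh.comp_ofReal

section Renewal

variable {a b b' l z : ℂ} {u v g A B : ℝ → ℂ} {T : ℝ}

/-- The renewal equation `u(t) = e^{at} + ∫₀ᵗ e^{ax} g(t - x) dx`, `t ≥ 0`, which is the integrated
form of the initial value problem `u' = a u + g`, `u(0) = 1`. -/
def IsRenewalSolution (a : ℂ) (u g : ℝ → ℂ) : Prop :=
  ∀ t, 0 ≤ t → u t = Complex.exp (a * t) + ∫ x in (0 : ℝ)..t, Complex.exp (a * x) * g (t - x)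

namespace IsRenewalSolution

theorem apply_zero (h : IsRenewalSolution a u g) : u 0 = 1 := by
  simpa using h 0 le_rfl

theorem congr {g' : ℝ → ℂ} (h : IsRenewalSolution a u g) (hg : Set.EqOn g g' (Set.Ioi 0)) :
    IsRenewalSolution a u g' := fun t ht => by
  rw [h t ht, intervalIntegral.integral_congr_Ioo_of_le ht fun x hx => by
    rw [hg (Set.mem_Ioi.2 (sub_pos.2 hx.2))]]

theorem eq_exp_mul (h : IsRenewalSolution a u g) {t : ℝ} (ht : 0 ≤ t) :
    u t = Complex.exp (a * t) * (1 + ∫ s in (0 : ℝ)..t, Complex.exp (-(a * s)) * g s) := by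
  have hsub := intervalIntegral.integral_comp_sub_left (a := 0) (b := t)
    (fun s => Complex.exp (a * (t - s : ℝ)) * g s) t
  simp only [sub_sub_cancel, sub_self, sub_zero] at hsub
  rw [h t ht, hsub, mul_add, mul_one, ← intervalIntegral.integral_const_mul]
  congr 1
  refine intervalIntegral.integral_congr fun s _ => ?_
  simp only [← mul_assoc, ← Complex.exp_add]
  push_cast
  ring_nf

theorem continuousOn (h : IsRenewalSolution a u g) (hg : IntervalIntegrable g volume 0 T)
    (hT : 0 ≤ T) : ContinuousOn u (Set.Icc 0 T) := by
  have hint := hg.continuousOn_mul (g := fun s : ℝ => Complex.exp (-(a * s))) (by fun_prop)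
  have hprim := intervalIntegral.continuousOn_primitive_interval' hint Set.left_mem_uIcc
  rw [Set.uIcc_of_le hT] at hprim
  exact ContinuousOn.congr (by fun_prop) fun t ht => h.eq_exp_mul ht.1

theorem hasDerivWithinAt (h : IsRenewalSolution a u g) (hg : ContinuousOn g (Set.Icc 0 T))
    {t : ℝ} (ht : t ∈ Set.Icc 0 T) :
    HasDerivWithinAt u (a * u t + g t) (Set.Icc 0 T) t := by
  have : Fact (t ∈ Set.Icc 0 T) := ⟨ht⟩
  have hcont : ContinuousOn (fun s : ℝ => Complex.exp (-(a * s)) * g s) (Set.Icc 0 T) := by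
    fun_prop
  have hprim := intervalIntegral.integral_hasDerivWithinAt_right (s := Set.Icc 0 T)
    ((hcont.mono (Set.Icc_subset_Icc_right ht.2)).intervalIntegrable_of_Icc ht.1)
    (hcont.stronglyMeasurableAtFilter_nhdsWithin measurableSet_Icc t) (hcont t ht)
  refine (((hasDerivAt_cexp_mul_ofReal a t).hasDerivWithinAt.mul (hprim.const_add 1)).congr
    (fun s hs => h.eq_exp_mul hs.1) (h.eq_exp_mul ht.1)).congr_deriv ?_
  rw [h.eq_exp_mul ht.1, ← mul_assoc, ← Complex.exp_add, add_neg_cancel, Complex.exp_zero]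
  ring

theorem eq_and_eq_of_hasDerivAt {a' : ℂ} {f f' : ℝ → ℂ}
    (hu : IsRenewalSolution a u fun s => b * v s) (hv : IsRenewalSolution a' v fun s => b' * u s)
    (hui : IntervalIntegrable u volume 0 T) (hvi : IntervalIntegrable v volume 0 T)
    (hf : ∀ t, HasDerivAt f (a * f t + b * f' t) t)
    (hf' : ∀ t, HasDerivAt f' (a' * f' t + b' * f t) t) (hf0 : f 0 = 1) (hf'0 : f' 0 = 1)
    (hT : 0 ≤ T) : u T = f T ∧ v T = f' T := by
  let V : ℂ × ℂ →L[ℝ] ℂ × ℂ :=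
    (a • ContinuousLinearMap.fst ℝ ℂ ℂ + b • ContinuousLinearMap.snd ℝ ℂ ℂ).prod
      (a' • ContinuousLinearMap.snd ℝ ℂ ℂ + b' • ContinuousLinearMap.fst ℝ ℂ ℂ)
  have hu_cont := hu.continuousOn (hvi.const_mul b) hT
  have hv_cont := hv.continuousOn (hui.const_mul b') hT
  have hsol : ∀ t, HasDerivAt (fun s => (f s, f' s)) (V (f t, f' t)) t := fun t =>
    (hf t).prodMk (hf' t)
  have huv : Set.EqOn (fun t => (u t, v t)) (fun t => (f t, f' t)) (Set.Icc 0 T) := by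
    refine ODE_solution_unique (v := fun _ => V) (fun _ => V.lipschitz) (hu_cont.prodMk hv_cont)
      (fun t ht => ?_) (fun t _ => (hsol t).continuousAt.continuousWithinAt)
      (fun t _ => (hsol t).hasDerivWithinAt) ?_
    · have hderiv := (hu.hasDerivWithinAt (by fun_prop) (Set.Ico_subset_Icc_self ht)).prodMk
        (hv.hasDerivWithinAt (by fun_prop) (Set.Ico_subset_Icc_self ht))
      exact hderiv.mono_of_mem_nhdsWithin (Icc_mem_nhdsGE_of_mem ht)
    · simp only [hu.apply_zero, hv.apply_zero, hf0, hf'0]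
  exact Prod.ext_iff.1 (huv ⟨hT, le_rfl⟩)

theorem add_eq (hu : IsRenewalSolution (l + z) u fun s => b * v s)
    (hv : IsRenewalSolution (l - z) v fun s => b' * u s)
    (hui : IntervalIntegrable u volume 0 T) (hvi : IntervalIntegrable v volume 0 T)
    (hA : ∀ t, HasDerivAt A ((b * b' + z ^ 2) * B t) t) (hB : ∀ t, HasDerivAt B (A t) t)
    (hA0 : A 0 = 1) (hB0 : B 0 = 0) (hT : 0 ≤ T) :
    u T + v T = Complex.exp (l * T) * (2 * A T + (b + b') * B T) := by
  -- Up to `l • 1`, the matrix `M` of the system has a scalar square, whence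
  -- `exp (t M) = A t • 1 + B t • M`.
  have hderiv (w : ℂ) (t : ℝ) :
      HasDerivAt (fun t : ℝ => Complex.exp (l * t) * (A t + w * B t))
        (Complex.exp (l * t) * (l * (A t + w * B t) + ((b * b' + z ^ 2) * B t + w * A t))) t := by
    refine ((hasDerivAt_cexp_mul_ofReal l t).mul
      ((hA t).add ((hB t).const_mul w))).congr_deriv ?_
    simp only [Pi.add_apply]
    ring
  obtain ⟨huT, hvT⟩ := hu.eq_and_eq_of_hasDerivAt hv hui hvi
    (fun t => (hderiv (z + b) t).congr_deriv (by ring))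
    (fun t => (hderiv (-z + b') t).congr_deriv (by ring))
    (by simp [hA0, hB0]) (by simp [hA0, hB0]) hT
  rw [huT, hvT]
  ring

end IsRenewalSolution

end Renewal

section Independence

variable {Ω α β γ E : Type*} [MeasurableSpace Ω] {μ : Measure Ω} [MeasurableSpace α]
  [MeasurableSpace β] [MeasurableSpace γ] [NormedAddCommGroup E] [NormedSpace ℝ E]

theorem indepFun_zero_tail {X : ℕ → Ω → α} (h : iIndepFun X μ) (hX : ∀ n, Measurable (X n)) :
    IndepFun (X 0) (fun ω n => X (n + 1) ω) μ := by
  have hdisj := indep_iSup_of_disjoint (fun n => (hX n).comap_le)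
    ((iIndepFun_iff_iIndep _ _ _).1 h) (S := {0}) (T := {n | 0 < n}) (by simp)
  rw [IndepFun_iff_Indep]
  refine indep_of_indep_of_le_left (indep_of_indep_of_le_right hdisj ?_) (by simp)
  rw [MeasurableSpace.pi, MeasurableSpace.comap_iSup]
  refine iSup_le fun n => ?_
  rw [MeasurableSpace.comap_comp]
  exact le_iSup₂_of_le (n + 1) n.succ_pos le_rfl

variable [IsProbabilityMeasure μ]

theorem indepFun_prodMk_of_prodMk {X : Ω → α} {Y : Ω → β} {Z : Ω → γ} (hX : Measurable X)
    (hY : Measurable Y) (hZ : Measurable Z) (hXY : IndepFun X Y μ)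
    (hXYZ : IndepFun (fun ω => (X ω, Y ω)) Z μ) : IndepFun X (fun ω => (Y ω, Z ω)) μ := by
  have hYZ : IndepFun Y Z μ := hXYZ.comp measurable_snd measurable_id
  rw [indepFun_iff_map_prod_eq_prod_map_map (by fun_prop) (by fun_prop)] at *
  have := Measure.isProbabilityMeasure_map (μ := μ) hX.aemeasurable
  have := Measure.isProbabilityMeasure_map (μ := μ) hY.aemeasurable
  have := Measure.isProbabilityMeasure_map (μ := μ) hZ.aemeasurable
  rw [hYZ, ← Measure.prodAssoc_prod, ← hXY, ← hXYZ, Measure.map_map (by fun_prop) (by fun_prop)]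
  rfl

theorem integral_comp_of_indepFun {X : Ω → α} {Y : Ω → β} (hX : Measurable X) (hY : Measurable Y)
    (h : IndepFun X Y μ) {G : α × β → E} (hG : StronglyMeasurable G) {C : ℝ}
    (hC : ∀ z, ‖G z‖ ≤ C) :
    ∫ ω, G (X ω, Y ω) ∂μ = ∫ x, ∫ ω, G (x, Y ω) ∂μ ∂(μ.map X) := by
  have := Measure.isProbabilityMeasure_map (μ := μ) hX.aemeasurable
  have := Measure.isProbabilityMeasure_map (μ := μ) hY.aemeasurable
  rw [← integral_map (φ := fun ω => (X ω, Y ω)) (by fun_prop) hG.aestronglyMeasurable,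
    h.map_prod_eq_prod_map_map (by fun_prop) (by fun_prop),
    integral_prod _ (Integrable.of_bound hG.aestronglyMeasurable C (ae_of_all _ hC))]
  congr 1 with x
  exact integral_map (by fun_prop) (hG.comp_measurable measurable_prodMk_left).aestronglyMeasurable

theorem ae_tendsto_sum_range_of_iIndepFun {X : ℕ → Ω → ℝ} (hX : ∀ n, Measurable (X n))
    (h : iIndepFun X μ) (hnonneg : ∀ᵐ ω ∂μ, ∀ n, 0 ≤ X n ω) {ε : ℝ} (hε : 0 < ε)
    (htail : ∑' n, μ (X n ⁻¹' Set.Ioi ε) = ⊤) :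
    ∀ᵐ ω ∂μ, Tendsto (fun n => ∑ k ∈ Finset.range n, X k ω) atTop atTop := by
  have hmeas (n : ℕ) : MeasurableSet (X n ⁻¹' Set.Ioi ε) := hX n measurableSet_Ioi
  have hindep : iIndepSet (fun n => X n ⁻¹' Set.Ioi ε) μ := (iIndepSet_iff_meas_biInter hmeas).2
    fun s => h.measure_inter_preimage_eq_mul s fun _ _ => measurableSet_Ioi
  have hlimsup : ∀ᵐ ω ∂μ, ω ∈ limsup (fun n => X n ⁻¹' Set.Ioi ε) atTop :=
    (prob_compl_eq_zero_iff (MeasurableSet.measurableSet_limsup hmeas)).2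
      (measure_limsup_eq_one hmeas hindep htail)
  filter_upwards [hlimsup, hnonneg] with ω hω hω_nonneg
  refine (not_summable_iff_tendsto_nat_atTop_of_nonneg hω_nonneg).1 fun hsum => ?_
  obtain ⟨n, hgt, hlt⟩ := ((mem_limsup_iff_frequently_mem.1 hω).and_eventually
    (hsum.tendsto_atTop_zero.eventually_lt_const hε)).exists
  exact lt_asymm hgt hlt

end Independence

section Exponential

variable {E : Type*} [NormedAddCommGroup E] [NormedSpace ℝ E] {r t : ℝ}

theorem ae_expMeasure_pos (hr : 0 < r) : ∀ᵐ x ∂expMeasure r, 0 < x := by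
  have := isProbabilityMeasure_expMeasure hr
  have hIic : (expMeasure r).real (Set.Iic 0) = 0 := by
    simp [← cdf_eq_real, cdf_expMeasure_eq hr]
  rw [measureReal_eq_zero_iff] at hIic
  simpa [ae_iff, ← Set.Iic_def] using hIic

theorem measureReal_expMeasure_Ioi (hr : 0 < r) (ht : 0 ≤ t) :
    (expMeasure r).real (Set.Ioi t) = Real.exp (-(r * t)) := by
  have := isProbabilityMeasure_expMeasure hr
  rw [← Set.compl_Iic, probReal_compl_eq_one_sub measurableSet_Iic, ← cdf_eq_real,
    cdf_expMeasure_eq hr, if_pos ht, sub_sub_cancel]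

theorem setIntegral_expMeasure_Iic (hr : 0 < r) (ht : 0 ≤ t) (f : ℝ → E) :
    ∫ x in Set.Iic t, f x ∂expMeasure r =
      ∫ x in (0 : ℝ)..t, (r * Real.exp (-(r * x))) • f x := by
  have hae : Set.Iic t =ᵐ[expMeasure r] Set.Ioc 0 t :=
    eventuallyEq_set.2 ((ae_expMeasure_pos hr).mono fun x hx => by simp [hx])
  have hdensity : Measurable (exponentialPDF r) := (measurable_exponentialPDFReal r).ennreal_ofReal
  rw [setIntegral_congr_set hae, intervalIntegral.integral_of_le ht]
  refine (setIntegral_withDensity_eq_setIntegral_toReal_smul hdensity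
    (ae_of_all _ fun _ => ENNReal.ofReal_lt_top) f measurableSet_Ioc).trans ?_
  refine setIntegral_congr_fun measurableSet_Ioc fun x hx => ?_
  simp only [exponentialPDF_of_nonneg hx.1.le,
    ENNReal.toReal_ofReal (mul_nonneg hr.le (Real.exp_nonneg _))]

theorem integral_expMeasure_piecewise_const [CompleteSpace E] (hr : 0 < r) (ht : 0 ≤ t) {f : ℝ → E}
    (hf : IntegrableOn f (Set.Iic t) (expMeasure r)) (K : E) :
    ∫ x, (Set.Iic t).piecewise f (fun _ => K) x ∂expMeasure r =
      (∫ x in (0 : ℝ)..t, (r * Real.exp (-(r * x))) • f x) + Real.exp (-(r * t)) • K := by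
  have := isProbabilityMeasure_expMeasure hr
  rw [integral_piecewise measurableSet_Iic hf (integrable_const K).integrableOn,
    setIntegral_expMeasure_Iic hr ht, Set.compl_Iic, setIntegral_const,
    measureReal_expMeasure_Ioi hr ht]

theorem integral_piecewise_of_indepFun {Ω β : Type*} [MeasurableSpace Ω] [MeasurableSpace β]
    [CompleteSpace E] {μ : Measure Ω} [IsProbabilityMeasure μ] {X : Ω → ℝ} {Y : Ω → β}
    (hX : Measurable X) (hY : Measurable Y) (h : IndepFun X Y μ) (hr : 0 < r)
    (hlaw : μ.map X = expMeasure r) (ht : 0 ≤ t) {F : ℝ × β → E} (hF : StronglyMeasurable F)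
    {K : E} {C : ℝ} (hFC : ∀ z, ‖F z‖ ≤ C) (hKC : ‖K‖ ≤ C) :
    ∫ ω, (Set.Iic t).piecewise (fun x => F (x, Y ω)) (fun _ => K) (X ω) ∂μ =
      (∫ x in (0 : ℝ)..t, (r * Real.exp (-(r * x))) • ∫ ω, F (x, Y ω) ∂μ) +
        Real.exp (-(r * t)) • K := by
  have := isProbabilityMeasure_expMeasure hr
  have hG : StronglyMeasurable fun z : ℝ × β => if z.1 ≤ t then F z else K :=
    hF.ite (measurableSet_le measurable_fst measurable_const) stronglyMeasurable_const
  have hGC (z : ℝ × β) : ‖if z.1 ≤ t then F z else K‖ ≤ C := by split_ifs <;> simp [hFC, hKC]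
  have hmean : StronglyMeasurable fun x => ∫ ω, F (x, Y ω) ∂μ :=
    (hF.comp_measurable (g := fun z : ℝ × Ω => (z.1, Y z.2)) (by fun_prop)).integral_prod_right'
  have hmeanC (x : ℝ) : ‖∫ ω, F (x, Y ω) ∂μ‖ ≤ C := by
    simpa using norm_integral_le_of_norm_le_const (ae_of_all μ fun ω => hFC (x, Y ω))
  calc ∫ ω, (Set.Iic t).piecewise (fun x => F (x, Y ω)) (fun _ => K) (X ω) ∂μ
      = ∫ x, ∫ ω, (if x ≤ t then F (x, Y ω) else K) ∂μ ∂(μ.map X) :=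
        integral_comp_of_indepFun hX hY h hG hGC
    _ = ∫ x, (Set.Iic t).piecewise (fun x => ∫ ω, F (x, Y ω) ∂μ) (fun _ => K) x ∂expMeasure r := by
        rw [hlaw]
        congr 1 with x
        by_cases hx : x ≤ t <;> simp [Set.piecewise, hx]
    _ = _ := integral_expMeasure_piecewise_const hr ht
        (Integrable.of_bound hmean.aestronglyMeasurable C (ae_of_all _ hmeanC)).integrableOn K

end Exponential

/-- The abscissa `cos (π j / 2)` of the unit vector labelled `j`. -/
noncomputable def dirX (j : ZMod 4) : ℝ := Real.cos (Real.pi / 2 * (j.val : ℝ))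

/-- The ordinate `sin (π j / 2)` of the unit vector labelled `j`. -/
noncomputable def dirY (j : ZMod 4) : ℝ := Real.sin (Real.pi / 2 * (j.val : ℝ))

theorem dirX_zero : dirX 0 = 1 := by simp [dirX]

theorem dirY_zero : dirY 0 = 0 := by simp [dirY]

theorem dirX_one : dirX 1 = 0 := by simp [dirX, show (1 : ZMod 4).val = 1 from rfl]

theorem dirY_one : dirY 1 = 1 := by simp [dirY, show (1 : ZMod 4).val = 1 from rfl]

theorem dirX_add_dirY_two : dirX 2 + dirY 2 = -1 := by
  simp [dirX, dirY, show (2 : ZMod 4).val = 2 from rfl]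

theorem dirX_add_dirY_neg_one : dirX (-1) + dirY (-1) = -1 := by
  have hangle : Real.pi / 2 * 3 = Real.pi / 2 + Real.pi := by ring
  simp [dirX, dirY, show (-1 : ZMod 4).val = 3 from rfl, hangle, Real.cos_add_pi, Real.sin_add_pi]

theorem dirX_add_dirY_le_one (j : ZMod 4) : dirX j + dirY j ≤ 1 := by
  obtain rfl | rfl | rfl | rfl : j = 0 ∨ j = 1 ∨ j = 2 ∨ j = -1 := by decide +revert
  · simp [dirX_zero, dirY_zero]
  · simp [dirX_one, dirY_one]
  · linarith [dirX_add_dirY_two]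
  · linarith [dirX_add_dirY_neg_one]

section Measurability

variable {Ω : Type*} [MeasurableSpace Ω] {D₀ : Ω → ZMod 4} {τ : ℕ → Ω → ℝ} {ξ : ℕ → Ω → ZMod 4}

theorem measurable_eventCount (hτ : ∀ n, Measurable (τ n)) :
    Measurable fun z : ℝ × Ω => eventCount τ z.1 z.2 := by
  refine measurable_ncard.comp (measurable_set_iff.2 fun n => ?_)
  have harrival : Measurable (arrivalTime τ n) := Finset.measurable_sum _ fun k _ => hτ k
  exact (measurable_const (a := 1 ≤ n)).and
    (measurableSet_setOfPred.1 (measurableSet_le (harrival.comp measurable_snd) measurable_fst))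

theorem measurable_direction (hD : Measurable D₀) (hτ : ∀ n, Measurable (τ n))
    (hξ : ∀ n, Measurable (ξ n)) : Measurable fun z : ℝ × Ω => direction D₀ τ ξ z.1 z.2 := by
  have hlabel : Measurable fun x : ℕ × Ω => D₀ x.2 + ∑ k ∈ Finset.range x.1, ξ k x.2 :=
    measurable_from_prod_countable_right fun n =>
      hD.add (Finset.measurable_sum (Finset.range n) fun k _ => hξ k)
  exact hlabel.comp ((measurable_eventCount hτ).prodMk measurable_snd)

theorem measurable_integral_direction (hD : Measurable D₀) (hτ : ∀ n, Measurable (τ n))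
    (hξ : ∀ n, Measurable (ξ n)) (g : ZMod 4 → ℝ) :
    Measurable fun z : ℝ × Ω => ∫ s in (0 : ℝ)..z.1, g (direction D₀ τ ξ s z.2) := by
  have hint : Measurable fun x : (ℝ × Ω) × ℝ => g (direction D₀ τ ξ (x.1.1 * x.2) x.1.2) :=
    (Measurable.of_discrete (f := g)).comp ((measurable_direction hD hτ hξ).comp
      (f := fun x : (ℝ × Ω) × ℝ => (x.1.1 * x.2, x.1.2)) (by fun_prop))
  -- Rescaling to `(0, 1]` makes the domain of integration independent of `z`.
  have hrescale : ∀ z : ℝ × Ω, ∫ s in (0 : ℝ)..z.1, g (direction D₀ τ ξ s z.2) =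
      z.1 * ∫ r in Set.Ioc (0 : ℝ) 1, g (direction D₀ τ ξ (z.1 * r) z.2) := fun z => by
    rw [← intervalIntegral.integral_of_le zero_le_one, ← smul_eq_mul,
      intervalIntegral.smul_integral_comp_mul_left (fun s => g (direction D₀ τ ξ s z.2)),
      mul_zero, mul_one]
  simp only [hrescale]
  exact measurable_fst.mul hint.stronglyMeasurable.integral_prod_right.measurable

theorem measurable_sideExp (hD : Measurable D₀) (hτ : ∀ n, Measurable (τ n))
    (hξ : ∀ n, Measurable (ξ n)) (c α : ℝ) :
    Measurable fun z : ℝ × Ω => sideExp c D₀ τ ξ α z.1 z.2 := by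
  have hX : Measurable fun z : ℝ × Ω => posX c D₀ τ ξ z.1 z.2 :=
    measurable_integral_direction hD hτ hξ fun j => c * dirX j
  have hY : Measurable fun z : ℝ × Ω => posY c D₀ τ ξ z.1 z.2 :=
    measurable_integral_direction hD hτ hξ fun j => c * dirY j
  have hside : MeasurableSet {z : ℝ × Ω |
      posX c D₀ τ ξ z.1 z.2 + posY c D₀ τ ξ z.1 z.2 = c * z.1} :=
    measurableSet_eq_fun (hX.add hY) (measurable_fst.const_mul c)
  exact Measurable.ite hside (by fun_prop) measurable_const

theorem measurable_sideExp_apply (hD : Measurable D₀) (hτ : ∀ n, Measurable (τ n))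
    (hξ : ∀ n, Measurable (ξ n)) (c α t : ℝ) : Measurable (sideExp c D₀ τ ξ α t) := by
  have hsection := (measurable_sideExp hD hτ hξ c α).comp (measurable_prodMk_left (x := t))
  exact hsection

end Measurability

section Path

variable {Ω : Type*} {D₀ : Ω → ZMod 4} {τ : ℕ → Ω → ℝ} {ξ : ℕ → Ω → ZMod 4} {ω : Ω} {c α t : ℝ}

theorem norm_sideExp_le_one (c : ℝ) (D₀ : Ω → ZMod 4) (τ : ℕ → Ω → ℝ) (ξ : ℕ → Ω → ZMod 4)
    (α t : ℝ) (ω : Ω) : ‖sideExp c D₀ τ ξ α t ω‖ ≤ 1 := by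
  refine (norm_indicator_le_norm_self _ _).trans_eq ?_
  rw [mul_comm, Complex.norm_exp_ofReal_mul_I]

theorem measurable_direction_time (D₀ : Ω → ZMod 4) (τ : ℕ → Ω → ℝ) (ξ : ℕ → Ω → ZMod 4)
    (ω : Ω) : Measurable fun s => direction D₀ τ ξ s ω := by
  let _ : MeasurableSpace Ω := ⊤
  exact (measurable_direction measurable_from_top (fun _ => measurable_from_top)
    fun _ => measurable_from_top).comp (measurable_id.prodMk measurable_const)

theorem intervalIntegrable_direction (D₀ : Ω → ZMod 4) (τ : ℕ → Ω → ℝ) (ξ : ℕ → Ω → ZMod 4)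
    (ω : Ω) (g : ZMod 4 → ℝ) (a b : ℝ) :
    IntervalIntegrable (fun s => g (direction D₀ τ ξ s ω)) volume a b := by
  obtain ⟨C, hC⟩ := (Set.finite_range g).isBounded.exists_norm_le
  have hg := (Measurable.of_discrete (f := g)).comp (measurable_direction_time D₀ τ ξ ω)
  exact (intervalIntegrable_const (c := C)).mono_fun hg.aestronglyMeasurable
    (ae_of_all _ fun s => (hC _ (Set.mem_range_self _)).trans (le_abs_self C))

theorem arrivalTime_succ_eq_add_shift (τ : ℕ → Ω → ℝ) (n : ℕ) (ω : Ω) :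
    arrivalTime τ (n + 1) ω = τ 0 ω + arrivalTime (fun k => τ (k + 1)) n ω := by
  rw [arrivalTime, Finset.sum_range_succ', add_comm, arrivalTime]

theorem le_arrivalTime (hpos : ∀ k, 0 < τ k ω) {n : ℕ} (hn : 1 ≤ n) :
    τ 0 ω ≤ arrivalTime τ n ω :=
  Finset.single_le_sum (f := fun k => τ k ω) (fun k _ => (hpos k).le) (Finset.mem_range.2 hn)

theorem finite_setOf_arrivalTime_le (hlim : Tendsto (fun n => arrivalTime τ n ω) atTop atTop)
    (t : ℝ) : {n : ℕ | arrivalTime τ n ω ≤ t}.Finite := by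
  simpa [← Nat.cofinite_eq_atTop] using hlim.eventually_gt_atTop t

theorem eventCount_of_lt (hpos : ∀ k, 0 < τ k ω) (ht : t < τ 0 ω) : eventCount τ t ω = 0 := by
  have hempty : {n : ℕ | 1 ≤ n ∧ arrivalTime τ n ω ≤ t} = ∅ :=
    Set.eq_empty_of_forall_notMem fun n hn =>
      (ht.trans_le (le_arrivalTime hpos hn.1)).not_ge hn.2
  rw [eventCount, hempty, Set.ncard_empty]

theorem eventCount_of_le (hlim : Tendsto (fun n => arrivalTime τ n ω) atTop atTop)
    (ht : τ 0 ω ≤ t) :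
    eventCount τ t ω = eventCount (fun k => τ (k + 1)) (t - τ 0 ω) ω + 1 := by
  let S : Set ℕ := {n | 1 ≤ n ∧ arrivalTime (fun k => τ (k + 1)) n ω ≤ t - τ 0 ω}
  have hshift (n : ℕ) : arrivalTime (fun k => τ (k + 1)) n ω ≤ t - τ 0 ω ↔
      arrivalTime τ (n + 1) ω ≤ t := by
    rw [arrivalTime_succ_eq_add_shift, le_sub_iff_add_le']
  have hset : {n : ℕ | 1 ≤ n ∧ arrivalTime τ n ω ≤ t} = insert 1 (Nat.succ '' S) := by
    ext n
    rcases n with _ | _ | n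
    · simp
    · simp [arrivalTime, ht]
    · simp [S, hshift]
  have hfin : S.Finite :=
    ((finite_setOf_arrivalTime_le hlim t).preimage Nat.succ_injective.injOn).subset
      fun n hn => (hshift n).1 hn.2
  rw [eventCount, hset, Set.ncard_insert_of_notMem (by simp [S]) (hfin.image _),
    Set.ncard_image_of_injective _ Nat.succ_injective]
  rfl

theorem direction_of_lt (hpos : ∀ k, 0 < τ k ω) (ht : t < τ 0 ω) :
    direction D₀ τ ξ t ω = D₀ ω := by
  simp [direction, eventCount_of_lt hpos ht]

theorem direction_of_le (hlim : Tendsto (fun n => arrivalTime τ n ω) atTop atTop)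
    (ht : τ 0 ω ≤ t) :
    direction D₀ τ ξ t ω =
      direction (fun ω => D₀ ω + ξ 0 ω) (fun k => τ (k + 1)) (fun k => ξ (k + 1))
        (t - τ 0 ω) ω := by
  simp only [direction, eventCount_of_le hlim ht, Finset.sum_range_succ']
  ring

theorem integral_direction_of_le_wait (hpos : ∀ k, 0 < τ k ω) (g : ZMod 4 → ℝ)
    (ht : 0 ≤ t) (htτ : t ≤ τ 0 ω) :
    ∫ s in (0 : ℝ)..t, g (direction D₀ τ ξ s ω) = g (D₀ ω) * t := by
  rw [intervalIntegral.integral_congr_Ioo_of_le (g := fun _ => g (D₀ ω)) ht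
    fun s hs => by simp only [direction_of_lt hpos (hs.2.trans_le htτ)]]
  simp [mul_comm]

theorem integral_direction_of_wait_le (hpos : ∀ k, 0 < τ k ω)
    (hlim : Tendsto (fun n => arrivalTime τ n ω) atTop atTop) (g : ZMod 4 → ℝ)
    (ht : τ 0 ω ≤ t) :
    ∫ s in (0 : ℝ)..t, g (direction D₀ τ ξ s ω) = g (D₀ ω) * τ 0 ω +
      ∫ s in (0 : ℝ)..(t - τ 0 ω), g (direction (fun ω => D₀ ω + ξ 0 ω) (fun k => τ (k + 1))
        (fun k => ξ (k + 1)) s ω) := by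
  have hafter : ∫ s in (τ 0 ω)..t, g (direction D₀ τ ξ s ω) =
      ∫ s in (τ 0 ω)..t, g (direction (fun ω => D₀ ω + ξ 0 ω) (fun k => τ (k + 1))
        (fun k => ξ (k + 1)) (s - τ 0 ω) ω) := by
    refine intervalIntegral.integral_congr fun s hs => ?_
    rw [Set.uIcc_of_le ht] at hs
    simp only [direction_of_le hlim hs.1]
  rw [← intervalIntegral.integral_add_adjacent_intervals
      (intervalIntegrable_direction D₀ τ ξ ω g 0 (τ 0 ω))
      (intervalIntegrable_direction D₀ τ ξ ω g (τ 0 ω) t),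
    integral_direction_of_le_wait hpos g (hpos 0).le le_rfl, hafter,
    intervalIntegral.integral_comp_sub_right (fun s => g (direction (fun ω => D₀ ω + ξ 0 ω)
      (fun k => τ (k + 1)) (fun k => ξ (k + 1)) s ω)), sub_self]

theorem posX_of_le_wait (hpos : ∀ k, 0 < τ k ω) (ht : 0 ≤ t) (htτ : t ≤ τ 0 ω) :
    posX c D₀ τ ξ t ω = c * dirX (D₀ ω) * t :=
  integral_direction_of_le_wait hpos (fun j => c * dirX j) ht htτ

theorem posY_of_le_wait (hpos : ∀ k, 0 < τ k ω) (ht : 0 ≤ t) (htτ : t ≤ τ 0 ω) :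
    posY c D₀ τ ξ t ω = c * dirY (D₀ ω) * t :=
  integral_direction_of_le_wait hpos (fun j => c * dirY j) ht htτ

theorem posX_of_wait_le (hpos : ∀ k, 0 < τ k ω)
    (hlim : Tendsto (fun n => arrivalTime τ n ω) atTop atTop) (hτt : τ 0 ω ≤ t) :
    posX c D₀ τ ξ t ω = c * dirX (D₀ ω) * τ 0 ω +
      posX c (fun ω => D₀ ω + ξ 0 ω) (fun k => τ (k + 1)) (fun k => ξ (k + 1)) (t - τ 0 ω) ω :=
  integral_direction_of_wait_le hpos hlim (fun j => c * dirX j) hτt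

theorem posY_of_wait_le (hpos : ∀ k, 0 < τ k ω)
    (hlim : Tendsto (fun n => arrivalTime τ n ω) atTop atTop) (hτt : τ 0 ω ≤ t) :
    posY c D₀ τ ξ t ω = c * dirY (D₀ ω) * τ 0 ω +
      posY c (fun ω => D₀ ω + ξ 0 ω) (fun k => τ (k + 1)) (fun k => ξ (k + 1)) (t - τ 0 ω) ω :=
  integral_direction_of_wait_le hpos hlim (fun j => c * dirY j) hτt

theorem posX_add_posY_le (hc : 0 ≤ c) (ht : 0 ≤ t) (D₀ : Ω → ZMod 4) (τ : ℕ → Ω → ℝ)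
    (ξ : ℕ → Ω → ZMod 4) (ω : Ω) : posX c D₀ τ ξ t ω + posY c D₀ τ ξ t ω ≤ c * t := by
  have hX := intervalIntegrable_direction D₀ τ ξ ω (fun j => c * dirX j) 0 t
  have hY := intervalIntegrable_direction D₀ τ ξ ω (fun j => c * dirY j) 0 t
  calc posX c D₀ τ ξ t ω + posY c D₀ τ ξ t ω
      = ∫ s in (0 : ℝ)..t, (c * dirX (direction D₀ τ ξ s ω) + c * dirY (direction D₀ τ ξ s ω)) :=
        (intervalIntegral.integral_add hX hY).symm
    _ ≤ ∫ _ in (0 : ℝ)..t, c :=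
        intervalIntegral.integral_mono ht (hX.add hY) intervalIntegrable_const fun s => by
          simpa [mul_add] using
            mul_le_mul_of_nonneg_left (dirX_add_dirY_le_one (direction D₀ τ ξ s ω)) hc
    _ = c * t := by simp [mul_comm]

theorem posX_add_posY_lt (hc : 0 < c) (ht : 0 < t) (hpos : ∀ k, 0 < τ k ω)
    (hlim : Tendsto (fun n => arrivalTime τ n ω) atTop atTop)
    (hD : dirX (D₀ ω) + dirY (D₀ ω) = -1) :
    posX c D₀ τ ξ t ω + posY c D₀ τ ξ t ω < c * t := by
  rcases le_total t (τ 0 ω) with htτ | hτt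
  · rw [posX_of_le_wait hpos ht.le htτ, posY_of_le_wait hpos ht.le htτ]
    linear_combination c * t * hD + 2 * mul_pos hc ht
  · have hle := posX_add_posY_le hc.le (sub_nonneg.2 hτt) (fun ω => D₀ ω + ξ 0 ω)
      (fun k => τ (k + 1)) (fun k => ξ (k + 1)) ω
    rw [posX_of_wait_le hpos hlim hτt, posY_of_wait_le hpos hlim hτt]
    linear_combination hle + c * τ 0 ω * hD + 2 * mul_pos hc (hpos 0)

theorem sideExp_eq_zero (hc : 0 < c) (ht : 0 < t) (hpos : ∀ k, 0 < τ k ω)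
    (hlim : Tendsto (fun n => arrivalTime τ n ω) atTop atTop)
    (hD : dirX (D₀ ω) + dirY (D₀ ω) = -1) : sideExp c D₀ τ ξ α t ω = 0 := by
  rw [sideExp, Set.indicator_of_notMem]
  exact (posX_add_posY_lt hc ht hpos hlim hD).ne

theorem sideExp_of_le_wait (hpos : ∀ k, 0 < τ k ω) (hD : dirX (D₀ ω) + dirY (D₀ ω) = 1)
    (ht : 0 ≤ t) (htτ : t ≤ τ 0 ω) :
    sideExp c D₀ τ ξ α t ω =
      Complex.exp (Complex.I * (α * c * (dirX (D₀ ω) - dirY (D₀ ω)) : ℝ) * t) := by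
  have hside : c * dirX (D₀ ω) * t + c * dirY (D₀ ω) * t = c * t := by
    linear_combination c * t * hD
  simp only [sideExp, Set.indicator_apply, Set.mem_ofPred_eq, posX_of_le_wait hpos ht htτ,
    posY_of_le_wait hpos ht htτ, if_pos hside]
  congr 1
  push_cast
  ring

theorem sideExp_of_wait_le (hpos : ∀ k, 0 < τ k ω)
    (hlim : Tendsto (fun n => arrivalTime τ n ω) atTop atTop)
    (hD : dirX (D₀ ω) + dirY (D₀ ω) = 1) (hτt : τ 0 ω ≤ t) :
    sideExp c D₀ τ ξ α t ω =
      Complex.exp (Complex.I * (α * c * (dirX (D₀ ω) - dirY (D₀ ω)) : ℝ) * τ 0 ω) *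
        sideExp c (fun ω => D₀ ω + ξ 0 ω) (fun k => τ (k + 1)) (fun k => ξ (k + 1)) α
          (t - τ 0 ω) ω := by
  simp only [sideExp, Set.indicator_apply, Set.mem_ofPred_eq, posX_of_wait_le hpos hlim hτt,
    posY_of_wait_le hpos hlim hτt, mul_ite, mul_zero]
  refine if_congr ⟨fun h => ?_, fun h => ?_⟩ ?_ rfl
  · linear_combination h - c * τ 0 ω * hD
  · linear_combination h + c * τ 0 ω * hD
  · rw [← Complex.exp_add]
    congr 1
    push_cast
    ring

theorem sideExp_eq_piecewise (hpos : ∀ k, 0 < τ k ω)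
    (hlim : Tendsto (fun n => arrivalTime τ n ω) atTop atTop)
    (hD : dirX (D₀ ω) + dirY (D₀ ω) = 1) (ht : 0 ≤ t) :
    sideExp c D₀ τ ξ α t ω =
      (Set.Iic t).piecewise
        (fun x => Complex.exp (Complex.I * (α * c * (dirX (D₀ ω) - dirY (D₀ ω)) : ℝ) * x) *
          sideExp c (fun ω => D₀ ω + ξ 0 ω) (fun k => τ (k + 1)) (fun k => ξ (k + 1)) α (t - x) ω)
        (fun _ => Complex.exp (Complex.I * (α * c * (dirX (D₀ ω) - dirY (D₀ ω)) : ℝ) * t))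
        (τ 0 ω) := by
  by_cases hτt : τ 0 ω ≤ t
  · rw [Set.piecewise_eq_of_mem _ _ _ (Set.mem_Iic.2 hτt), sideExp_of_wait_le hpos hlim hD hτt]
  · rw [Set.piecewise_eq_of_notMem _ _ _ (Set.mem_Iic.not.2 hτt),
      sideExp_of_le_wait hpos hD ht (not_le.1 hτt).le]

end Path

section Motion

variable {Ω : Type*} [MeasurableSpace Ω] {μ : Measure Ω} {lam p q c α t : ℝ} {D₀ : Ω → ZMod 4}
  {τ : ℕ → Ω → ℝ} {ξ : ℕ → Ω → ZMod 4} {j : ZMod 4}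

theorem sum_zmod_four {M : Type*} [AddCommMonoid M] (f : ZMod 4 → M) :
    ∑ a, f a = f 0 + f 1 + f 2 + f (-1) :=
  Fin.sum_univ_four f

namespace IsMotionData

theorem shift (h : IsMotionData μ lam p q D₀ τ ξ) :
    IsMotionData μ lam p q D₀ (fun n => τ (n + 1)) (fun n => ξ (n + 1)) where
  measurable_init := h.measurable_init
  measurable_wait n := h.measurable_wait _
  measurable_turn n := h.measurable_turn _
  prob_init := h.prob_init
  law_wait n := h.law_wait _
  prob_ccw n := h.prob_ccw _
  prob_cw n := h.prob_cw _
  prob_reverse n := h.prob_reverse _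
  indep_wait := h.indep_wait.precomp Nat.succ_injective
  indep_turn := h.indep_turn.precomp Nat.succ_injective
  indep_wait_turn := h.indep_wait_turn.comp (φ := fun (x : ℕ → ℝ) n => x (n + 1))
    (ψ := fun (y : ℕ → ZMod 4) n => y (n + 1)) (by fun_prop) (by fun_prop)
  indep_init := h.indep_init.comp (φ := id)
    (ψ := fun z : (ℕ → ℝ) × (ℕ → ZMod 4) => (fun n => z.1 (n + 1), fun n => z.2 (n + 1)))
    measurable_id (by fun_prop)

theorem ae_wait_pos (h : IsMotionData μ lam p q D₀ τ ξ) (hlam : 0 < lam) :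
    ∀ᵐ ω ∂μ, ∀ n, 0 < τ n ω := by
  refine ae_all_iff.2 fun n => ?_
  have hpos := ae_expMeasure_pos hlam
  rw [← h.law_wait n] at hpos
  exact ae_of_ae_map (h.measurable_wait n).aemeasurable hpos

variable [IsProbabilityMeasure μ]

theorem ae_tendsto_arrivalTime (h : IsMotionData μ lam p q D₀ τ ξ) (hlam : 0 < lam) :
    ∀ᵐ ω ∂μ, Tendsto (fun n => arrivalTime τ n ω) atTop atTop := by
  refine ae_tendsto_sum_range_of_iIndepFun h.measurable_wait h.indep_wait
    ((h.ae_wait_pos hlam).mono fun ω hω n => (hω n).le) one_pos ?_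
  have htail (n : ℕ) : μ (τ n ⁻¹' Set.Ioi 1) = expMeasure lam (Set.Ioi 1) := by
    rw [← h.law_wait n, Measure.map_apply (h.measurable_wait n) measurableSet_Ioi]
  have hne : expMeasure lam (Set.Ioi 1) ≠ 0 := fun h0 => by
    have hreal := measureReal_expMeasure_Ioi hlam zero_le_one
    rw [Measure.real, h0, ENNReal.toReal_zero] at hreal
    exact (Real.exp_pos _).ne hreal
  simpa only [htail] using ENNReal.tsum_const_eq_top_of_ne_zero hne

theorem indepFun_zero_wait (h : IsMotionData μ lam p q D₀ τ ξ) :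
    IndepFun (τ 0) (fun ω => (ξ 0 ω, fun n => τ (n + 1) ω, fun n => ξ (n + 1) ω)) μ := by
  have hτ := h.measurable_wait
  have hξ := h.measurable_turn
  have hτξ : IndepFun (fun ω => (τ 0 ω, fun n => τ (n + 1) ω)) (fun ω n => ξ n ω) μ :=
    h.indep_wait_turn.comp (φ := fun x => (x 0, fun n => x (n + 1))) (ψ := id)
      (by fun_prop) measurable_id
  have hrest := indepFun_prodMk_of_prodMk (hτ 0) (by fun_prop) (by fun_prop)
    (indepFun_zero_tail h.indep_wait hτ) hτξ
  exact hrest.comp (φ := id) (ψ := fun z => (z.2 0, z.1, fun n => z.2 (n + 1))) measurable_id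
    (by fun_prop)

theorem indepFun_zero_turn (h : IsMotionData μ lam p q D₀ τ ξ) :
    IndepFun (ξ 0) (fun ω => (fun n => τ (n + 1) ω, fun n => ξ (n + 1) ω)) μ := by
  have hτ := h.measurable_wait
  have hξ := h.measurable_turn
  have hξτ : IndepFun (fun ω => (ξ 0 ω, fun n => ξ (n + 1) ω)) (fun ω n => τ (n + 1) ω) μ :=
    h.indep_wait_turn.symm.comp (φ := fun y => (y 0, fun n => y (n + 1)))
      (ψ := fun x n => x (n + 1)) (by fun_prop) (by fun_prop)
  have hrest := indepFun_prodMk_of_prodMk (hξ 0) (by fun_prop) (by fun_prop)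
    (indepFun_zero_tail h.indep_turn hξ) hξτ
  exact hrest.comp (φ := id) (ψ := Prod.swap) measurable_id measurable_swap

theorem measureReal_map_turn (h : IsMotionData μ lam p q D₀ τ ξ) (hp : 0 ≤ p) (hq : 0 ≤ q)
    (hpq : p + q ≤ 1) (n : ℕ) :
    (μ.map (ξ n)).real {0} = 0 ∧ (μ.map (ξ n)).real {1} = p ∧
      (μ.map (ξ n)).real {2} = 1 - p - q ∧ (μ.map (ξ n)).real {-1} = q := by
  have := Measure.isProbabilityMeasure_map (μ := μ) (h.measurable_turn n).aemeasurable
  have hreal {a : ZMod 4} {x : ℝ} (hx : 0 ≤ x) (ha : μ {ω | ξ n ω = a} = ENNReal.ofReal x) :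
      (μ.map (ξ n)).real {a} = x := by
    rw [map_measureReal_apply (h.measurable_turn n) (measurableSet_singleton a)]
    exact (congrArg ENNReal.toReal ha).trans (ENNReal.toReal_ofReal hx)
  have hccw := hreal hp (h.prob_ccw n)
  have hcw := hreal hq (h.prob_cw n)
  have hrev := hreal (by linarith) (h.prob_reverse n)
  have htotal : ∑ a : ZMod 4, (μ.map (ξ n)).real {a} = 1 := by simp
  rw [sum_zmod_four] at htotal
  exact ⟨by linarith, hccw, hrev, hcw⟩

theorem integral_turn (h : IsMotionData μ lam p q D₀ τ ξ) (hp : 0 ≤ p) (hq : 0 ≤ q)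
    (hpq : p + q ≤ 1) (n : ℕ) (φ : ZMod 4 → ℂ) :
    ∫ a, φ a ∂(μ.map (ξ n)) = p * φ 1 + (1 - p - q : ℝ) * φ 2 + q * φ (-1) := by
  have := Measure.isProbabilityMeasure_map (μ := μ) (h.measurable_turn n).aemeasurable
  obtain ⟨hstay, hccw, hrev, hcw⟩ := h.measureReal_map_turn hp hq hpq n
  simp only [integral_fintype Integrable.of_finite, sum_zmod_four, hstay, hccw, hrev, hcw,
    Complex.real_smul, Complex.ofReal_zero, zero_mul, zero_add]

theorem integral_init (h : IsMotionData μ lam p q D₀ τ ξ) (φ : ZMod 4 → ℂ) :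
    ∫ a, φ a ∂(μ.map D₀) = (φ 0 + φ 1 + φ 2 + φ (-1)) / 4 := by
  have := Measure.isProbabilityMeasure_map (μ := μ) h.measurable_init.aemeasurable
  have hprob (a : ZMod 4) : (μ.map D₀).real {a} = 1 / 4 := by
    rw [map_measureReal_apply h.measurable_init (measurableSet_singleton a)]
    exact (congrArg ENNReal.toReal (h.prob_init a)).trans (by simp)
  simp only [integral_fintype Integrable.of_finite, sum_zmod_four, hprob, Complex.real_smul]
  push_cast
  ring

theorem map_turn_eq (h : IsMotionData μ lam p q D₀ τ ξ) (hp : 0 ≤ p) (hq : 0 ≤ q)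
    (hpq : p + q ≤ 1) (m n : ℕ) : μ.map (ξ m) = μ.map (ξ n) := by
  have := Measure.isProbabilityMeasure_map (μ := μ) (h.measurable_turn m).aemeasurable
  have := Measure.isProbabilityMeasure_map (μ := μ) (h.measurable_turn n).aemeasurable
  obtain ⟨hm0, hm1, hm2, hm3⟩ := h.measureReal_map_turn hp hq hpq m
  obtain ⟨hn0, hn1, hn2, hn3⟩ := h.measureReal_map_turn hp hq hpq n
  refine Measure.ext_of_singleton fun a => (measureReal_eq_measureReal_iff).1 ?_
  obtain rfl | rfl | rfl | rfl : a = 0 ∨ a = 1 ∨ a = 2 ∨ a = -1 := by decide +revert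
  · rw [hm0, hn0]
  · rw [hm1, hn1]
  · rw [hm2, hn2]
  · rw [hm3, hn3]

theorem identDistrib_shift (h : IsMotionData μ lam p q D₀ τ ξ) (hp : 0 ≤ p) (hq : 0 ≤ q)
    (hpq : p + q ≤ 1) :
    IdentDistrib (fun ω => (fun n => τ (n + 1) ω, fun n => ξ (n + 1) ω))
      (fun ω => (fun n => τ n ω, fun n => ξ n ω)) μ μ := by
  have hτ (n : ℕ) : IdentDistrib (τ (n + 1)) (τ n) μ μ :=
    ⟨(h.measurable_wait _).aemeasurable, (h.measurable_wait _).aemeasurable, by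
      rw [h.law_wait, h.law_wait]⟩
  have hξ (n : ℕ) : IdentDistrib (ξ (n + 1)) (ξ n) μ μ :=
    ⟨(h.measurable_turn _).aemeasurable, (h.measurable_turn _).aemeasurable,
      h.map_turn_eq hp hq hpq _ _⟩
  exact (IdentDistrib.pi hτ h.shift.indep_wait h.indep_wait).prodMk
    (IdentDistrib.pi hξ h.shift.indep_turn h.indep_turn) h.shift.indep_wait_turn h.indep_wait_turn

end IsMotionData

/-- The mean of `e^{iα(X(t) - Y(t))} 1{X(t) + Y(t) = ct}` for the particle whose initial direction
has the label `j`. -/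
noncomputable def sideMean (μ : Measure Ω) (c : ℝ) (τ : ℕ → Ω → ℝ) (ξ : ℕ → Ω → ZMod 4) (α : ℝ)
    (j : ZMod 4) (t : ℝ) : ℂ :=
  ∫ ω, sideExp c (fun _ => j) τ ξ α t ω ∂μ

variable [IsProbabilityMeasure μ]

theorem intervalIntegrable_sideMean (hτ : ∀ n, Measurable (τ n))
    (hξ : ∀ n, Measurable (ξ n)) (c α : ℝ) (j : ZMod 4) (a b : ℝ) :
    IntervalIntegrable (sideMean μ c τ ξ α j) volume a b := by
  have hmeas : StronglyMeasurable (sideMean μ c τ ξ α j) :=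
    (measurable_sideExp measurable_const hτ hξ c α).stronglyMeasurable.integral_prod_right
  refine (intervalIntegrable_const (c := (1 : ℝ))).mono_fun hmeas.aestronglyMeasurable
    (ae_of_all _ fun t => ?_)
  simpa [sideMean] using norm_integral_le_of_norm_le_const
    (ae_of_all μ fun ω => norm_sideExp_le_one c (fun _ => j) τ ξ α t ω)

theorem integral_sideExp_eq_integral_sideMean {D : Ω → ZMod 4}
    (hD : Measurable D) (hτ : ∀ n, Measurable (τ n)) (hξ : ∀ n, Measurable (ξ n))
    (hindep : IndepFun D (fun ω => (fun n => τ n ω, fun n => ξ n ω)) μ) (c α t : ℝ) :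
    ∫ ω, sideExp c D τ ξ α t ω ∂μ = ∫ j, sideMean μ c τ ξ α j t ∂(μ.map D) :=
  integral_comp_of_indepFun hD (by fun_prop) hindep
    (G := sideExp c Prod.fst (fun n w => w.2.1 n) (fun n w => w.2.2 n) α t)
    (measurable_sideExp_apply measurable_fst (by fun_prop) (by fun_prop) c α t).stronglyMeasurable
    (norm_sideExp_le_one _ _ _ _ _ _)

namespace IsMotionData

theorem sideMean_shift (h : IsMotionData μ lam p q D₀ τ ξ) (hp : 0 ≤ p)
    (hq : 0 ≤ q) (hpq : p + q ≤ 1) (c α : ℝ) (j : ZMod 4) (t : ℝ) :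
    sideMean μ c (fun n => τ (n + 1)) (fun n => ξ (n + 1)) α j t = sideMean μ c τ ξ α j t := by
  let S : (ℕ → ℝ) × (ℕ → ZMod 4) → ℂ :=
    sideExp c (fun _ => j) (fun n w => w.1 n) (fun n w => w.2 n) α t
  have hS : Measurable S :=
    measurable_sideExp_apply measurable_const (by fun_prop) (by fun_prop) c α t
  calc sideMean μ c (fun n => τ (n + 1)) (fun n => ξ (n + 1)) α j t
      = ∫ ω, S (fun n => τ (n + 1) ω, fun n => ξ (n + 1) ω) ∂μ := rfl
    _ = ∫ ω, S (fun n => τ n ω, fun n => ξ n ω) ∂μ :=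
        ((h.identDistrib_shift hp hq hpq).comp hS).integral_eq
    _ = sideMean μ c τ ξ α j t := rfl

theorem sideMean_eq_zero (h : IsMotionData μ lam p q D₀ τ ξ)
    (hlam : 0 < lam) (hc : 0 < c) (hj : dirX j + dirY j = -1) (α : ℝ) (ht : 0 < t) :
    sideMean μ c τ ξ α j t = 0 := by
  refine integral_eq_zero_of_ae ?_
  filter_upwards [h.ae_wait_pos hlam, h.ae_tendsto_arrivalTime hlam] with ω hpos hlim
  exact sideExp_eq_zero hc ht hpos hlim hj

theorem integral_sideExp_zero_turn (h : IsMotionData μ lam p q D₀ τ ξ)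
    (hp : 0 ≤ p) (hq : 0 ≤ q) (hpq : p + q ≤ 1) (c α : ℝ) (j : ZMod 4) (t : ℝ) :
    ∫ ω, sideExp c (fun ω => j + ξ 0 ω) (fun n => τ (n + 1)) (fun n => ξ (n + 1)) α t ω ∂μ =
      p * sideMean μ c τ ξ α (j + 1) t + (1 - p - q : ℝ) * sideMean μ c τ ξ α (j + 2) t +
        q * sideMean μ c τ ξ α (j + -1) t := by
  have hadd : Measurable fun a : ZMod 4 => j + a := .of_discrete
  have hmap : μ.map (fun ω => j + ξ 0 ω) = (μ.map (ξ 0)).map fun a => j + a :=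
    (Measure.map_map hadd (h.measurable_turn 0)).symm
  rw [integral_sideExp_eq_integral_sideMean (D := fun ω => j + ξ 0 ω)
      (hadd.comp (h.measurable_turn 0)) h.shift.measurable_wait h.shift.measurable_turn
      (h.indepFun_zero_turn.comp hadd measurable_id), hmap,
    integral_map hadd.aemeasurable .of_discrete, h.integral_turn hp hq hpq]
  simp only [h.sideMean_shift hp hq hpq]

theorem sideMean_eq_add_integral (h : IsMotionData μ lam p q D₀ τ ξ)
    (hlam : 0 < lam) (hj : dirX j + dirY j = 1) (c α : ℝ) (ht : 0 ≤ t) :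
    sideMean μ c τ ξ α j t =
      (∫ x in (0 : ℝ)..t, (lam * Real.exp (-(lam * x))) •
        (Complex.exp (Complex.I * (α * c * (dirX j - dirY j) : ℝ) * x) *
          ∫ ω, sideExp c (fun ω => j + ξ 0 ω) (fun n => τ (n + 1)) (fun n => ξ (n + 1)) α
            (t - x) ω ∂μ)) +
      Real.exp (-(lam * t)) • Complex.exp (Complex.I * (α * c * (dirX j - dirY j) : ℝ) * t) := by
  let phase (x : ℝ) : ℂ := Complex.exp (Complex.I * (α * c * (dirX j - dirY j) : ℝ) * x)
  let S (s : ℝ) : ZMod 4 × (ℕ → ℝ) × (ℕ → ZMod 4) → ℂ :=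
    sideExp c (fun w => j + w.1) (fun n w => w.2.1 n) (fun n w => w.2.2 n) α s
  have hphase (x : ℝ) : ‖phase x‖ = 1 := by
    simp [phase, Complex.norm_exp]
  have hS : Measurable fun z : ℝ × ZMod 4 × (ℕ → ℝ) × (ℕ → ZMod 4) => S (t - z.1) z.2 :=
    (measurable_sideExp (Measurable.of_discrete.comp measurable_fst) (by fun_prop) (by fun_prop)
      c α).comp (f := fun z : ℝ × ZMod 4 × (ℕ → ℝ) × (ℕ → ZMod 4) => (t - z.1, z.2)) (by fun_prop)
  have hF : StronglyMeasurable fun z : ℝ × ZMod 4 × (ℕ → ℝ) × (ℕ → ZMod 4) =>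
      phase z.1 * S (t - z.1) z.2 :=
    (Measurable.mul (by fun_prop) hS).stronglyMeasurable
  have hFC (z : ℝ × ZMod 4 × (ℕ → ℝ) × (ℕ → ZMod 4)) : ‖phase z.1 * S (t - z.1) z.2‖ ≤ 1 := by
    rw [norm_mul, hphase, one_mul]
    exact norm_sideExp_le_one _ _ _ _ _ _ _
  have hτ := h.measurable_wait
  have hξ := h.measurable_turn
  simp only [← integral_const_mul]
  refine (integral_congr_ae ?_).trans (integral_piecewise_of_indepFun (hτ 0) (by fun_prop)
    h.indepFun_zero_wait hlam (h.law_wait 0) ht hF hFC (hphase t).le)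
  filter_upwards [h.ae_wait_pos hlam, h.ae_tendsto_arrivalTime hlam] with ω hpos hlim
  exact sideExp_eq_piecewise hpos hlim hj ht

theorem isRenewalSolution_sideMean (h : IsMotionData μ lam p q D₀ τ ξ)
    (hlam : 0 < lam) (hp : 0 ≤ p) (hq : 0 ≤ q) (hpq : p + q ≤ 1) (hj : dirX j + dirY j = 1)
    (c α : ℝ) :
    IsRenewalSolution (-lam + Complex.I * (α * c * (dirX j - dirY j) : ℝ))
      (sideMean μ c τ ξ α j) fun s => lam * (p * sideMean μ c τ ξ α (j + 1) s +
        (1 - p - q : ℝ) * sideMean μ c τ ξ α (j + 2) s + q * sideMean μ c τ ξ α (j + -1) s) := by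
  intro t ht
  have hexp (x : ℝ) : Complex.exp ((-lam + Complex.I * (α * c * (dirX j - dirY j) : ℝ)) * x) =
      Real.exp (-(lam * x)) * Complex.exp (Complex.I * (α * c * (dirX j - dirY j) : ℝ) * x) := by
    rw [Complex.ofReal_exp, ← Complex.exp_add]
    push_cast
    ring_nf
  rw [h.sideMean_eq_add_integral hlam hj c α ht, add_comm, hexp, Complex.real_smul]
  congr 1
  refine intervalIntegral.integral_congr fun x _ => ?_
  simp only [h.integral_sideExp_zero_turn hp hq hpq, hexp, Complex.real_smul]
  push_cast
  ring

theorem isRenewalSolution_sideMean_zero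
    (h : IsMotionData μ lam p q D₀ τ ξ) (hlam : 0 < lam) (hc : 0 < c) (hp : 0 ≤ p) (hq : 0 ≤ q)
    (hpq : p + q ≤ 1) (α : ℝ) :
    IsRenewalSolution (-lam + Complex.I * (α * c : ℝ)) (sideMean μ c τ ξ α 0)
      fun s => (lam * p : ℝ) * sideMean μ c τ ξ α 1 s := by
  have hrenewal := h.isRenewalSolution_sideMean hlam hp hq hpq (j := 0)
    (by simp [dirX_zero, dirY_zero]) c α
  rw [dirX_zero, dirY_zero, sub_zero, mul_one] at hrenewal
  refine hrenewal.congr fun s hs => ?_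
  simp only [zero_add, h.sideMean_eq_zero hlam hc dirX_add_dirY_two α hs,
    h.sideMean_eq_zero hlam hc dirX_add_dirY_neg_one α hs]
  push_cast
  ring

theorem isRenewalSolution_sideMean_one
    (h : IsMotionData μ lam p q D₀ τ ξ) (hlam : 0 < lam) (hc : 0 < c) (hp : 0 ≤ p) (hq : 0 ≤ q)
    (hpq : p + q ≤ 1) (α : ℝ) :
    IsRenewalSolution (-lam - Complex.I * (α * c : ℝ)) (sideMean μ c τ ξ α 1)
      fun s => (lam * q : ℝ) * sideMean μ c τ ξ α 0 s := by
  have hrenewal := h.isRenewalSolution_sideMean hlam hp hq hpq (j := 1)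
    (by simp [dirX_one, dirY_one]) c α
  rw [dirX_one, dirY_one, zero_sub, mul_neg_one, Complex.ofReal_neg, mul_neg, ← sub_eq_add_neg]
    at hrenewal
  refine hrenewal.congr fun s hs => ?_
  have hccw : (1 + 1 : ZMod 4) = 2 := rfl
  have hrev : (1 + 2 : ZMod 4) = -1 := rfl
  simp only [hccw, hrev, add_neg_cancel, h.sideMean_eq_zero hlam hc dirX_add_dirY_two α hs,
    h.sideMean_eq_zero hlam hc dirX_add_dirY_neg_one α hs]
  push_cast
  ring

theorem integrable_sideExp (h : IsMotionData μ lam p q D₀ τ ξ)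
    (c α t : ℝ) : Integrable (sideExp c D₀ τ ξ α t) μ :=
  .of_bound (measurable_sideExp_apply h.measurable_init h.measurable_wait h.measurable_turn
    c α t).aestronglyMeasurable 1 (ae_of_all _ (norm_sideExp_le_one c D₀ τ ξ α t))

theorem integral_sideExp_eq_sideMean_add
    (h : IsMotionData μ lam p q D₀ τ ξ) (hlam : 0 < lam) (hc : 0 < c) (ht : 0 < t) (α : ℝ) :
    ∫ ω, sideExp c D₀ τ ξ α t ω ∂μ = (sideMean μ c τ ξ α 0 t + sideMean μ c τ ξ α 1 t) / 4 := by
  rw [integral_sideExp_eq_integral_sideMean h.measurable_init h.measurable_wait h.measurable_turn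
      h.indep_init, h.integral_init, h.sideMean_eq_zero hlam hc dirX_add_dirY_two α ht,
    h.sideMean_eq_zero hlam hc dirX_add_dirY_neg_one α ht, add_zero, add_zero]

theorem integral_sideExp_eq (h : IsMotionData μ lam p q D₀ τ ξ)
    (hlam : 0 < lam) (hc : 0 < c) (ht : 0 < t) (hp : 0 ≤ p) (hq : 0 ≤ q) (hpq : p + q ≤ 1)
    {A B : ℝ → ℂ} (hA : ∀ s, HasDerivAt A ((lam ^ 2 * p * q - α ^ 2 * c ^ 2 : ℝ) * B s) s)
    (hB : ∀ s, HasDerivAt B (A s) s) (hA0 : A 0 = 1) (hB0 : B 0 = 0) :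
    ∫ ω, sideExp c D₀ τ ξ α t ω ∂μ =
      Complex.exp (-(lam * t)) / 4 * (2 * A t + (lam * (p + q) : ℝ) * B t) := by
  have hcoeff : ((lam * p : ℝ) * (lam * q : ℝ) + (Complex.I * (α * c : ℝ)) ^ 2 : ℂ) =
      (lam ^ 2 * p * q - α ^ 2 * c ^ 2 : ℝ) := by
    rw [mul_pow, Complex.I_sq]
    push_cast
    ring
  have hint (j : ZMod 4) := intervalIntegrable_sideMean (μ := μ) h.measurable_wait
    h.measurable_turn c α j 0 t
  rw [h.integral_sideExp_eq_sideMean_add hlam hc ht α,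
    (h.isRenewalSolution_sideMean_zero hlam hc hp hq hpq α).add_eq
      (h.isRenewalSolution_sideMean_one hlam hc hp hq hpq α) (hint 0) (hint 1)
      (fun s => hcoeff ▸ hA s) hB hA0 hB0 ht.le]
  push_cast
  ring_nf

end IsMotionData

end Motion

theorem mainTheorem5 {Ω : Type*} [MeasurableSpace Ω] (μ : Measure Ω) [IsProbabilityMeasure μ]
    (lam c p q : ℝ) (hlam : 0 < lam) (hc : 0 < c) (hp : 0 ≤ p) (hq : 0 ≤ q) (hpq : p + q ≤ 1)
    (D₀ : Ω → ZMod 4) (τ : ℕ → Ω → ℝ) (ξ : ℕ → Ω → ZMod 4)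
    (hmotion : IsMotionData μ lam p q D₀ τ ξ) (α t : ℝ) (ht : 0 < t) :
    Integrable (sideExp c D₀ τ ξ α t) μ ∧
    (∀ s : ℂ, s ^ 2 = ((lam ^ 2 * p * q - α ^ 2 * c ^ 2 : ℝ) : ℂ) → s ≠ 0 →
      ∫ ω, sideExp c D₀ τ ξ α t ω ∂μ =
        Complex.exp (-(lam : ℂ) * (t : ℂ)) / 4 *
          ((1 + (lam : ℂ) * ((p : ℂ) + (q : ℂ)) / (2 * s)) * Complex.exp ((t : ℂ) * s) +
            (1 - (lam : ℂ) * ((p : ℂ) + (q : ℂ)) / (2 * s)) * Complex.exp (-((t : ℂ) * s)))) ∧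
    (lam ^ 2 * p * q - α ^ 2 * c ^ 2 = 0 →
      ∫ ω, sideExp c D₀ τ ξ α t ω ∂μ =
        Complex.exp (-(lam : ℂ) * (t : ℂ)) / 4 *
          (2 + (lam : ℂ) * ((p : ℂ) + (q : ℂ)) * (t : ℂ))) := by
  refine ⟨hmotion.integrable_sideExp c α t, fun s hs hs0 => ?_, fun hdisc => ?_⟩
  · rw [hmotion.integral_sideExp_eq hlam hc ht hp hq hpq (A := fun x => Complex.cosh (s * x))
        (B := fun x => Complex.sinh (s * x) / s)
        (fun x => (hasDerivAt_cosh_mul_ofReal s x).congr_deriv (by rw [← hs]; field_simp))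
        (fun x => ((hasDerivAt_sinh_mul_ofReal s x).div_const s).congr_deriv (by field_simp))
        (by simp) (by simp)]
    simp only [Complex.cosh, Complex.sinh, mul_comm s, neg_mul]
    push_cast
    ring
  · rw [hmotion.integral_sideExp_eq hlam hc ht hp hq hpq (A := fun _ => 1) (B := fun x => (x : ℂ))
        (fun x => by simpa [hdisc] using hasDerivAt_const x (1 : ℂ))
        (fun x => Complex.ofRealCLM.hasDerivAt) rfl (by simp)]
    push_cast
    ring_nf
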